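/- **Setting.** Let $\mathbb{R}_B$ be the Bohr compactification of $\mathbb{R}$, i.e. the compact group of all characters of the additive group $\mathbb{R}$ equipped with the discrete topology, with normalised Haar measure $dc$. For $\mu\in\mathbb{R}$ let $h_\mu:\mathbb{R}_B\to\mathbb{C}$ be the character of $\mathbb{R}_B$ given by evaluation at $\mu$, and for $f:\mathbb{R}_B\to\mathbb{C}$ put $\widehat f_\mu=\int_{\mathbb{R}_B} f(c)\,h_{-\mu}(c)\,dc$. Let $\mathrm{Cyl}$ be the finite complex linear span of the $h_\mu$, let $\mathrm{Cyl}_d$ be its image under $f\mapsto \widehat f$ (the finitely supported functions $\mathbb{R}\to\mathbb{C}$), and let $\mathrm{Cyl}\otimes\mathrm{Cyl}_d$ be the finite span of the functions $(c,\mu)\mapsto f_1(c)f_2(\mu)$ on $\mathbb{R}_B\times\mathbb{R}$ with $f_1\in\mathrm{Cyl}$, $f_2\in\mathrm{Cyl}_d$. Stars denote algebraic duals. An element $\Gamma\in\mathrm{Cyl}^*$ is determined by its Fourier coefficients $\widehat\Gamma_\mu=\Gamma(h_{-\mu})$, which may form an arbitrary function $\mathbb{R}\to\mathbb{C}$. For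 $\Gamma,\Gamma'\in\mathrm{Cyl}^*$ the Wigner transform $W(\Gamma,\Gamma')\in(\mathrm{Cyl}\otimes\mathrm{Cyl}_d)^*$ is defined by the finite sum $$W(\Gamma,\Gamma')[F]=\sum_{\mu,\nu\in\mathbb{R}}\overline{\widehat\Gamma_{\mu+\nu/2}}\;\widehat{\Gamma'}_{\mu-\nu/2}\;\widehat F(\nu,\mu),\qquad \widehat F(\nu,\mu)=\int_{\mathbb{R}_B}F(c,\mu)\,h_{-\nu}(c)\,dc .$$ It is called positive if $W(\Gamma,\Gamma')[F]\ge 0$ for every pointwise nonnegative $F\in\mathrm{Cyl}\otimes\mathrm{Cyl}_d$. An element $\Gamma\in\mathrm{Cyl}^*$ is called Gaussian if there are $a,b,c\in\mathbb{C}$ with $\operatorname{Re}a>0$ such that $\widehat\Gamma_\mu=\exp(-a\mu^2+b\mu+c)$ for all $\mu\in\mathbb{R}$. **Proposition.** Let $\gamma\in L^2(\mathbb{R})\cap L^1(\mathbb{R})$ be a nonzero complex-valued function (i.e. not almost everywhere zero), and let $\Gamma\in\mathrm{Cyl}^*$ be defined by $$\widehat\Gamma_\mu=\widehat\gamma(\mu)=\int_{\mathbb{R}}\gamma(x)\,e^{-i\mu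 x}\,dx\qquad(\mu\in\mathbb{R}).$$ If $W(\Gamma,\Gamma)$ is positive, then $\Gamma$ is Gaussian. -/

import Mathlib

open MeasureTheory

namespace BohrWigner

/-- The additive group of the real numbers with the *discrete* topology, written
multiplicatively (Mathlib's Pontryagin dual is stated for multiplicative groups). -/
def DiscreteReal : Type := Multiplicative ℝ

instance : CommGroup DiscreteReal := inferInstanceAs (CommGroup (Multiplicative ℝ))

instance : TopologicalSpace DiscreteReal := ⊥

instance : DiscreteTopology DiscreteReal := ⟨rfl⟩

/-- A real number as an element of `DiscreteReal`. -/
def toDiscrete (μ : ℝ) : DiscreteReal := Multiplicative.ofAdd μ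

/-- The Bohr compactification of the real line: the (compact) dual group of the discrete
additive group `ℝ`. -/
abbrev RB : Type := PontryaginDual DiscreteReal

noncomputable instance : MeasurableSpace RB := borel RB

instance : BorelSpace RB := ⟨rfl⟩

/-- The Haar measure on `RB`, of total mass one. -/
noncomputable def haarRB : Measure RB := Measure.haarMeasure ⊤

/-- The character `h_μ` of `RB`, `μ ∈ ℝ`: evaluation at `μ`. -/
noncomputable def h (μ : ℝ) (c : RB) : ℂ :=
  ((c (toDiscrete μ) : Circle) : ℂ)

/-- The Fourier transform `f̂_μ = ∫ f(c) h_{-μ}(c) dc` of a function on `RB`. -/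
noncomputable def fourier (f : RB → ℂ) (μ : ℝ) : ℂ := ∫ c, f c * h (-μ) c ∂haarRB

/-- The cylindrical functions: the finite linear span of the characters `h_μ` of `RB`. -/
def Cyl : Submodule ℂ (RB → ℂ) := Submodule.span ℂ (Set.range h)

theorem h_mem_Cyl (μ : ℝ) : h μ ∈ Cyl := Submodule.subset_span ⟨μ, rfl⟩

theorem continuous_h (μ : ℝ) : Continuous (h μ) :=
  continuous_subtype_val.comp ((continuous_eval_const (F := C(DiscreteReal, Circle))
    (toDiscrete μ)).comp (ContinuousMonoidHom.isInducing_toContinuousMap DiscreteReal Circle).continuous)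

theorem h_add (μ ν : ℝ) (c : RB) : h (μ + ν) c = h μ c * h ν c := by
  have key : c (toDiscrete (μ + ν)) = c (toDiscrete μ) * c (toDiscrete ν) :=
    map_mul c (toDiscrete μ) (toDiscrete ν)
  simp only [h, key, Circle.coe_mul]

theorem h_zero (c : RB) : h 0 c = 1 := by
  have key : c (toDiscrete 0) = 1 := map_one c
  simp only [h, key, Circle.coe_one]

/-- The embedding of the real line in its Bohr compactification: `x ↦ (μ ↦ exp (i μ x))`. -/
noncomputable def ofReal (x : ℝ) : RB :=
  (⟨{ toFun := fun μ => Circle.exp (Multiplicative.toAdd (show Multiplicative ℝ from μ) * x)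
      map_one' := by
        change Circle.exp ((0 : ℝ) * x) = 1
        simp
      map_mul' := fun a b => by
        change Circle.exp ((Multiplicative.toAdd (show Multiplicative ℝ from a)
          + Multiplicative.toAdd (show Multiplicative ℝ from b)) * x) = _
        rw [add_mul, Circle.exp_add] }, continuous_of_discreteTopology⟩ : DiscreteReal →ₜ* Circle)

theorem h_ofReal (μ x : ℝ) : h μ (ofReal x) = Complex.exp (μ * x * Complex.I) := by
  change ((Circle.exp (μ * x) : Circle) : ℂ) = _
  rw [Circle.coe_exp]
  push_cast
  rfl

instance : IsProbabilityMeasure haarRB := by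
  refine ⟨?_⟩
  have := Measure.haarMeasure_self (G := RB) (K₀ := ⊤)
  simpa [haarRB] using this

instance : haarRB.IsMulLeftInvariant := by
  unfold haarRB; infer_instance

theorem integral_h (μ : ℝ) : ∫ c, h μ c ∂haarRB = if μ = 0 then 1 else 0 := by
  split_ifs with hμ
  · subst hμ
    simp [h_zero]
  · set x : ℝ := Real.pi / μ
    have h1 : h μ (ofReal x) = -1 := by
      rw [h_ofReal]
      have : (μ : ℂ) * (x : ℂ) = (Real.pi : ℂ) := by
        rw [← Complex.ofReal_mul]
        congr 1
        exact mul_div_cancel₀ _ hμ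
      rw [this, Complex.exp_pi_mul_I]
    have h2 : ∀ c : RB, h μ (ofReal x * c) = h μ (ofReal x) * h μ c := fun c => by
      change ((((ofReal x) _ * c _ : Circle)) : ℂ) = _
      rw [Circle.coe_mul]
      rfl
    have h3 := integral_mul_left_eq_self (μ := haarRB) (fun c => h μ c) (ofReal x)
    simp only [h2, h1, neg_mul, one_mul, integral_neg] at h3
    exact self_eq_neg.mp h3.symm

theorem integrable_of_continuous {f : RB → ℂ} (hf : Continuous f) : Integrable f haarRB :=
  hf.integrable_of_hasCompactSupport (HasCompactSupport.of_compactSpace f)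

theorem continuous_of_mem_Cyl {f : RB → ℂ} (hf : f ∈ Cyl) : Continuous f := by
  induction hf using Submodule.span_induction with
  | mem f hf => obtain ⟨μ, rfl⟩ := hf; exact continuous_h μ
  | zero => exact continuous_const
  | add f g _ _ hf hg => exact hf.add hg
  | smul a f _ hf => exact hf.const_smul a

theorem fourier_add {f g : RB → ℂ} (hf : Continuous f) (hg : Continuous g) :
    fourier (f + g) = fourier f + fourier g := by
  funext μ
  simp only [fourier, Pi.add_apply, add_mul]
  exact integral_add (integrable_of_continuous (hf.mul (continuous_h _)))
    (integrable_of_continuous (hg.mul (continuous_h _)))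

theorem fourier_smul (a : ℂ) (f : RB → ℂ) : fourier (a • f) = a • fourier f := by
  funext μ
  simp only [fourier, Pi.smul_apply, smul_eq_mul, mul_assoc]
  exact integral_const_mul a _

theorem fourier_h (μ : ℝ) : fourier (h μ) = Pi.single μ 1 := by
  funext ν
  simp only [fourier, ← h_add, integral_h, Pi.single_apply]
  simp only [add_neg_eq_zero, eq_comm]

theorem finite_support_fourier {f : RB → ℂ} (hf : f ∈ Cyl) : (fourier f).support.Finite := by
  induction hf using Submodule.span_induction with
  | mem f hf =>
    obtain ⟨μ, rfl⟩ := hf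
    rw [fourier_h]
    exact (Set.finite_singleton μ).subset Pi.support_single_subset
  | zero =>
    have : fourier (0 : RB → ℂ) = 0 := by funext μ; simp [fourier]
    simp [this]
  | add f g hf' hg' hf hg =>
    rw [fourier_add (continuous_of_mem_Cyl hf') (continuous_of_mem_Cyl hg')]
    exact (hf.union hg).subset (Function.support_add _ _)
  | smul a f _ hf =>
    rw [fourier_smul]
    exact hf.subset (Function.support_const_smul_subset a _)

/-- The Fourier transform as a linear map on `Cyl`. -/
noncomputable def cylFourier : Cyl →ₗ[ℂ] (ℝ → ℂ) where
  toFun Φ := fourier Φ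
  map_add' Φ Ψ := fourier_add (continuous_of_mem_Cyl Φ.2) (continuous_of_mem_Cyl Ψ.2)
  map_smul' a Φ := fourier_smul a Φ

/-- `Cyl` on the dual group: the image of `Cyl` under the Fourier transform. -/
noncomputable def CylDualGroup : Submodule ℂ (ℝ → ℂ) := LinearMap.range cylFourier

/-- The algebraic tensor product of `Cyl` and `CylDualGroup`, as the finite linear span of the
functions `(c, μ) ↦ f₁(c) f₂(μ)` on `RB × ℝ`. -/
noncomputable def CylPhase : Submodule ℂ (RB × ℝ → ℂ) :=
  Submodule.span ℂ {F | ∃ f₁ ∈ Cyl, ∃ f₂ ∈ CylDualGroup, F = fun p => f₁ p.1 * f₂ p.2}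

/-- The algebraic dual `Cyl*` (distributions on `RB`). -/
abbrev CylDist : Type := Module.Dual ℂ Cyl

/-- The algebraic dual of `CylPhase` (distributions on phase space). -/
abbrev CylPhaseDist : Type := Module.Dual ℂ CylPhase

/-- The Fourier coefficients `Γ̂_μ = Γ(h_{-μ})` of `Γ ∈ Cyl*`. -/
noncomputable def CylDist.coeff (Γ : CylDist) (μ : ℝ) : ℂ := Γ ⟨h (-μ), h_mem_Cyl (-μ)⟩

/-- Every function `g : ℝ → ℂ` is the family of Fourier coefficients of exactly one element of
`Cyl*`. -/
theorem CylDist.existsUnique_coeff (g : ℝ → ℂ) : ∃! Γ : CylDist, ∀ μ, Γ.coeff μ = g μ := by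
  refine ⟨{ toFun := fun Φ => ∑ᶠ μ, g μ * fourier Φ (-μ), map_add' := ?_, map_smul' := ?_ },
    ?_, ?_⟩
  · intro Φ Ψ
    have fin : ∀ Φ : Cyl, (Function.support fun μ => g μ * fourier Φ (-μ)).Finite := fun Φ =>
      ((finite_support_fourier Φ.2).preimage neg_injective.injOn).subset
        (fun μ hμ => right_ne_zero_of_mul hμ)
    rw [← finsum_add_distrib (fin Φ) (fin Ψ)]
    refine finsum_congr fun μ => ?_
    rw [Submodule.coe_add,
      fourier_add (continuous_of_mem_Cyl Φ.2) (continuous_of_mem_Cyl Ψ.2), Pi.add_apply, mul_add]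
  · intro a Φ
    rw [RingHom.id_apply, smul_finsum]
    refine finsum_congr fun μ => ?_
    rw [Submodule.coe_smul, fourier_smul, Pi.smul_apply, smul_eq_mul, smul_eq_mul, mul_left_comm]
  · intro μ
    change ∑ᶠ ν, g ν * fourier (h (-μ)) (-ν) = g μ
    rw [finsum_eq_single _ μ]
    · simp [fourier_h]
    · intro ν hν
      rw [fourier_h, Pi.single_eq_of_ne (by simpa using hν), mul_zero]
  · intro Γ' hΓ'
    refine LinearMap.ext fun Φ => ?_
    obtain ⟨f, hf⟩ := Φ
    induction hf using Submodule.span_induction with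
    | mem f hf =>
      obtain ⟨μ, rfl⟩ := hf
      change Γ' ⟨h μ, _⟩ = ∑ᶠ ν, g ν * fourier (h μ) (-ν)
      rw [finsum_eq_single _ (-μ)]
      · have := hΓ' (-μ)
        simp only [CylDist.coeff, neg_neg] at this
        simp [fourier_h, this]
      · intro ν hν
        rw [fourier_h, Pi.single_eq_of_ne (fun e => hν (by rw [← e, neg_neg])), mul_zero]
    | zero => exact (map_zero Γ').trans (map_zero _).symm
    | add f g hf hg h₁ h₂ =>
      have e : (⟨f + g, Cyl.add_mem hf hg⟩ : Cyl) = ⟨f, hf⟩ + ⟨g, hg⟩ := rfl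
      rw [e, map_add, map_add, h₁, h₂]
    | smul a f hf h₁ =>
      have e : (⟨a • f, Cyl.smul_mem a hf⟩ : Cyl) = a • ⟨f, hf⟩ := rfl
      rw [e, map_smul, map_smul, h₁]

/-- The partial Fourier transform `F̂(ν, μ) = ∫ F(c, μ) h_{-ν}(c) dc` in the first variable. -/
noncomputable def partialFourier (F : RB × ℝ → ℂ) (ν μ : ℝ) : ℂ :=
  fourier (fun c => F (c, μ)) ν

theorem continuous_of_mem_CylPhase {F : RB × ℝ → ℂ} (hF : F ∈ CylPhase) (μ : ℝ) :
    Continuous fun c => F (c, μ) := by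
  induction hF using Submodule.span_induction with
  | mem F hF =>
    obtain ⟨f₁, h₁, f₂, -, rfl⟩ := hF
    exact (continuous_of_mem_Cyl h₁).mul (continuous_const (y := f₂ μ))
  | zero => exact continuous_const
  | add F G _ _ hF hG => exact hF.add hG
  | smul a F _ hF => exact hF.const_smul a

theorem partialFourier_add {F G : RB × ℝ → ℂ} (hF : F ∈ CylPhase) (hG : G ∈ CylPhase)
    (ν μ : ℝ) : partialFourier (F + G) ν μ = partialFourier F ν μ + partialFourier G ν μ :=
  congrFun (fourier_add (continuous_of_mem_CylPhase hF μ) (continuous_of_mem_CylPhase hG μ)) ν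

theorem partialFourier_smul (a : ℂ) (F : RB × ℝ → ℂ) (ν μ : ℝ) :
    partialFourier (a • F) ν μ = a * partialFourier F ν μ :=
  congrFun (fourier_smul a fun c => F (c, μ)) ν

theorem finite_support_partialFourier {F : RB × ℝ → ℂ} (hF : F ∈ CylPhase) :
    (Function.support fun p : ℝ × ℝ => partialFourier F p.1 p.2).Finite := by
  induction hF using Submodule.span_induction with
  | mem F hF =>
    obtain ⟨f₁, h₁, _, ⟨Ψ, rfl⟩, rfl⟩ := hF
    refine ((finite_support_fourier h₁).prod (finite_support_fourier Ψ.2)).subset ?_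
    rintro ⟨ν, μ⟩ hp
    have e : partialFourier (fun p => f₁ p.1 * cylFourier Ψ p.2) ν μ
        = fourier Ψ μ * fourier f₁ ν := by
      rw [← smul_eq_mul, ← Pi.smul_apply, ← fourier_smul]
      unfold partialFourier
      congr 1
      funext c
      exact mul_comm _ _
    rw [Function.mem_support, e] at hp
    exact ⟨right_ne_zero_of_mul hp, left_ne_zero_of_mul hp⟩
  | zero => simp [partialFourier, fourier]
  | add F G hF' hG' hF hG =>
    refine (hF.union hG).subset ?_
    simp only [partialFourier_add hF' hG']
    exact Function.support_add _ _
  | smul a F _ hF =>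
    refine hF.subset ?_
    simp only [partialFourier_smul]
    exact fun p hp => right_ne_zero_of_mul hp

/-- The Wigner transform `W(Γ, Γ')` of `Γ, Γ' ∈ Cyl*`, the distribution on phase space
`F ↦ ∑_{ν, μ} conj(Γ̂_{μ+ν/2}) Γ̂'_{μ-ν/2} F̂(ν, μ)` (a finite sum for each `F`). -/
noncomputable def wigner (Γ Γ' : CylDist) : CylPhaseDist where
  toFun F := ∑ᶠ p : ℝ × ℝ,
    star (Γ.coeff (p.2 + p.1 / 2)) * Γ'.coeff (p.2 - p.1 / 2) * partialFourier F p.1 p.2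
  map_add' F G := by
    rw [← finsum_add_distrib
      ((finite_support_partialFourier F.2).subset fun p hp => right_ne_zero_of_mul hp)
      ((finite_support_partialFourier G.2).subset fun p hp => right_ne_zero_of_mul hp)]
    refine finsum_congr fun p => ?_
    rw [Submodule.coe_add, partialFourier_add F.2 G.2, mul_add]
  map_smul' a F := by
    rw [RingHom.id_apply, smul_finsum]
    refine finsum_congr fun p => ?_
    rw [Submodule.coe_smul, partialFourier_smul, smul_eq_mul, mul_left_comm]

open scoped ComplexOrder in
/-- A distribution on phase space is positive if it takes real nonnegative values on all pointwise
(real and) nonnegative elements of `CylPhase`. -/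
def CylPhaseDist.IsPositive (T : CylPhaseDist) : Prop :=
  ∀ F : CylPhase, (∀ p, 0 ≤ (F : RB × ℝ → ℂ) p) → 0 ≤ T F

/-- `Γ ∈ Cyl*` is Gaussian if `Γ̂_μ = exp (-a μ² + b μ + c)` with `a, b, c ∈ ℂ`, `Re a > 0`. -/
def CylDist.IsGaussian (Γ : CylDist) : Prop :=
  ∃ a b c : ℂ, 0 < a.re ∧ ∀ μ : ℝ, Γ.coeff μ = Complex.exp (-a * (μ : ℂ) ^ 2 + b * (μ : ℂ) + c)

end BohrWigner

/-! ### Zero-free entire functions of order at most two -/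

namespace Hudson

open Complex Metric

/-! Write `g` for the coefficient function of `Γ`. Being the Fourier transform of a nonzero
integrable function, `g` is continuous, bounded, nonzero and vanishes at infinity. Testing
positivity of the Wigner transform on `|∑ a_j h_{x_j}|²` at a single point `μ` shows that `φ_μ(ν) =
conj (g (μ + ν/2)) * g (μ - ν/2)` is positive definite in `ν`, for every `μ`
(`isPosDef_of_isPositive_wigner`).

What remains is Hudson's theorem. The transform `B(z) = ∫ g(t) exp (-t²/2 + z t) dt` is entire of
order at most two. Changing variables in `|B(z)|²` gives an integral over `μ` of a positive weight
times `∫ φ_μ(ν) e^{-i Im z ν} e^{-ν²/4} dν`. Positive definiteness makes the latter nonnegative, and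
strictly positive where `g μ ≠ 0`, so `B` has no zeros (`bargmann_ne_zero`). Hence `B` is the
exponential of a quadratic (`exists_eq_exp_quadratic`). On the imaginary axis `B` is the Fourier
transform of `g(t) e^{-t²/2}`; inverting it shows that `g` is the exponential of a quadratic, and
decay at infinity fixes the sign of the leading term (`eq_gaussian_of_isPosDef`). -/

theorem exists_differentiable_exp_eq {f : ℂ → ℂ} (hf : Differentiable ℂ f) (h0 : ∀ z, f z ≠ 0) :
    ∃ F : ℂ → ℂ, Differentiable ℂ F ∧ ∀ z, f z = exp (F z) := by
  have hd : Differentiable ℂ fun z => deriv f z / f z := hf.deriv.div hf h0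
  obtain ⟨F, hF0, hF⟩ := hd.isExactOn_univ.with_val_at 0 (log (f 0))
  have hF' : ∀ z, HasDerivAt F (deriv f z / f z) z := fun z => hF z trivial
  refine ⟨F, fun z => (hF' z).differentiableAt, fun z => ?_⟩
  -- Since `F' = f'/f`, the product `f * exp (-F)` is constant, and the normalisation `F 0 = log (f
  -- 0)` makes it `1`.
  have key : ∀ z, HasDerivAt (fun z => f z * exp (-F z)) 0 z := fun z => by
    convert! (hf z).hasDerivAt.mul (hF' z).neg.cexp using 1
    field_simp [h0 z]
    ring
  have hc := is_const_of_deriv_eq_zero (fun z => (key z).differentiableAt)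
    (fun z => (key z).deriv) z 0
  rw [hF0, exp_neg, exp_neg, exp_log (h0 0), mul_inv_cancel₀ (h0 0)] at hc
  exact (mul_inv_eq_one₀ (exp_ne_zero _)).mp hc

/-- Borel–Carathéodory on the disc of radius `2r`: for `‖z‖ ≤ r` the factors `‖z‖ / (2r - ‖z‖)` and
`(2r + ‖z‖) / (2r - ‖z‖)` are at most `1` and `3`. -/
theorem norm_le_of_re_le {F : ℂ → ℂ} (hF : Differentiable ℂ F) {C K : ℝ} (hC : 0 < C) (hK : 0 ≤ K)
    (hre : ∀ z, (F z).re ≤ C + K * ‖z‖ ^ 2) {r : ℝ} (hr : 0 < r) {z : ℂ} (hz : ‖z‖ ≤ r) :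
    ‖F z‖ ≤ 2 * (C + K * (2 * r) ^ 2) + 3 * ‖F 0‖ := by
  have hM : 0 < C + K * (2 * r) ^ 2 := by positivity
  refine (borelCaratheodory (R := 2 * r) hM hF.differentiableOn ?_ (by positivity)
    (mem_ball_zero_iff.mpr (by linarith))).trans ?_
  · intro w hw
    rw [mem_ball_zero_iff] at hw
    refine (hre w).trans ?_
    gcongr
  · have h1 : 0 < 2 * r - ‖z‖ := by linarith
    gcongr
    · rw [div_le_iff₀ h1]
      nlinarith
    · rw [div_le_iff₀ h1]
      nlinarith [norm_nonneg (F 0)]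

/-- Cauchy's estimate bounds the third derivative by `O(R²) / R³`, so it vanishes; two integrations
recover the quadratic. -/
theorem exists_quadratic_of_norm_le {F : ℂ → ℂ} (hF : Differentiable ℂ F) {C K : ℝ} (hC : 0 ≤ C)
    (hn : ∀ r, 0 < r → ∀ z, ‖z‖ ≤ r → ‖F z‖ ≤ C + K * r ^ 2) :
    ∃ a b c : ℂ, ∀ z, F z = a * z ^ 2 + b * z + c := by
  have h3 : ∀ z, iteratedDeriv 3 F z = 0 := by
    intro c
    have hb : ∀ᶠ R : ℝ in Filter.atTop,
        ‖iteratedDeriv 3 F c‖ ≤ 6 * (C + 4 * K) * R⁻¹ := by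
      -- `R ≥ ‖c‖` puts the circle about `c` inside the disc of radius `2R` about `0`; `R ≥ 1`
      -- absorbs `C` into `C * R²`.
      filter_upwards [Filter.eventually_ge_atTop 1, Filter.eventually_ge_atTop ‖c‖] with R h1 hc
      have hR : 0 < R := by linarith
      refine (norm_iteratedDeriv_le_of_forall_mem_sphere_norm_le (C := C + K * (2 * R) ^ 2) 3 hR
        hF.diffContOnCl fun z hz => hn (2 * R) (by positivity) z ?_).trans ?_
      · have : ‖z - c‖ = R := by simpa [dist_eq_norm] using hz
        have := norm_add_le (z - c) c
        rw [sub_add_cancel] at this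
        linarith
      · rw [div_le_iff₀ (by positivity)]
        have : 6 * (C + 4 * K) * R⁻¹ * R ^ 3 = 6 * (C + 4 * K) * R ^ 2 := by field_simp
        rw [this]
        norm_num [Nat.factorial]
        nlinarith [mul_le_mul_of_nonneg_left (one_le_pow₀ h1 : 1 ≤ R ^ 2) hC]
    have hl : Filter.Tendsto (fun R : ℝ => 6 * (C + 4 * K) * R⁻¹) Filter.atTop (nhds 0) := by
      simpa using tendsto_inv_atTop_zero.const_mul (6 * (C + 4 * K))
    exact norm_le_zero_iff.mp (ge_of_tendsto hl hb)
  have hd1 : Differentiable ℂ (deriv F) := hF.deriv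
  have hd2 : Differentiable ℂ (deriv (deriv F)) := hd1.deriv
  have c2 : ∀ z, deriv (deriv F) z = deriv (deriv F) 0 := fun z =>
    is_const_of_deriv_eq_zero hd2 (fun w => by simpa [iteratedDeriv_succ] using h3 w) z 0
  have c1 : ∀ z, deriv F z - deriv (deriv F) 0 * z = deriv F 0 := fun z => by
    have hk : ∀ z, HasDerivAt (fun z => deriv F z - deriv (deriv F) 0 * z) 0 z := fun z => by
      convert! (hd1 z).hasDerivAt.sub ((hasDerivAt_id z).const_mul (deriv (deriv F) 0)) using 1
      simp [c2 z]
    simpa using is_const_of_deriv_eq_zero (fun z => (hk z).differentiableAt)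
      (fun z => (hk z).deriv) z 0
  have c0 : ∀ z, F z - (deriv (deriv F) 0 / 2 * z ^ 2 + deriv F 0 * z) = F 0 := fun z => by
    have hk : ∀ z, HasDerivAt
        (fun z => F z - (deriv (deriv F) 0 / 2 * z ^ 2 + deriv F 0 * z)) 0 z := fun z => by
      convert! (hF z).hasDerivAt.sub (((hasDerivAt_pow 2 z).const_mul (deriv (deriv F) 0 / 2)).add
        ((hasDerivAt_id z).const_mul (deriv F 0))) using 1
      rw [← c1 z]
      push_cast
      ring
    simpa using is_const_of_deriv_eq_zero (fun z => (hk z).differentiableAt)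
      (fun z => (hk z).deriv) z 0
  exact ⟨deriv (deriv F) 0 / 2, deriv F 0, F 0, fun z => by linear_combination c0 z⟩

/-- A zero-free entire function of order at most two is the exponential of a quadratic
polynomial. -/
theorem exists_eq_exp_quadratic {f : ℂ → ℂ} (hf : Differentiable ℂ f) (h0 : ∀ z, f z ≠ 0)
    {C K : ℝ} (hC : 0 < C) (hK : 0 ≤ K) (hn : ∀ z, ‖f z‖ ≤ Real.exp (C + K * ‖z‖ ^ 2)) :
    ∃ a b c : ℂ, ∀ z, f z = exp (a * z ^ 2 + b * z + c) := by
  obtain ⟨F, hF, hfF⟩ := exists_differentiable_exp_eq hf h0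
  have hre : ∀ z, (F z).re ≤ C + K * ‖z‖ ^ 2 := fun z => by
    have := hn z
    rwa [hfF, norm_exp, Real.exp_le_exp] at this
  obtain ⟨a, b, c, habc⟩ := exists_quadratic_of_norm_le hF (C := 2 * C + 3 * ‖F 0‖) (K := 8 * K)
    (by positivity) fun r hr z hz =>
      (norm_le_of_re_le hF hC hK hre hr hz).trans (by linarith)
  exact ⟨a, b, c, fun z => by rw [hfF, habc]⟩

end Hudson

/-! ### Positive definite functions integrated against Gaussians -/

namespace Hudson

open Complex ProbabilityTheory
open scoped ComplexOrder ComplexConjugate NNReal FourierTransform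

/-- A complex function on the real line is positive definite if all the matrices
`φ (x j - x k)` are positive semidefinite. -/
def IsPosDef (φ : ℝ → ℂ) : Prop :=
  ∀ (n : ℕ) (x : Fin n → ℝ) (a : Fin n → ℂ),
    0 ≤ ∑ j, ∑ k, a j * conj (a k) * φ (x j - x k)

/-- The phase at `x j - x k` factors, so it is absorbed by replacing `a j` with `a j * exp (I * y *
x j)`. -/
theorem IsPosDef.mul_exp {φ : ℝ → ℂ} (hφ : IsPosDef φ) (y : ℝ) :
    IsPosDef fun ν => φ ν * exp (I * y * ν) := by
  intro n x a
  refine (hφ n x fun j => a j * exp (I * y * x j)).trans_eq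
    (Finset.sum_congr rfl fun j _ => Finset.sum_congr rfl fun k _ => ?_)
  have : exp (I * y * ((x j - x k : ℝ) : ℂ)) = exp (I * y * x j) * conj (exp (I * y * x k)) := by
    rw [← exp_conj, ← exp_add]
    congr 1
    simp
    ring
  simp only [this, map_mul]
  ring

theorem map_sub_pi_gaussianReal {n : ℕ} (v : ℝ≥0) {j k : Fin n} (hjk : j ≠ k) :
    (Measure.pi fun _ : Fin n => gaussianReal 0 v).map (fun x => x j - x k)
      = gaussianReal 0 (2 * v) := by
  have hX : ∀ i : Fin n, (Measure.pi fun _ : Fin n => gaussianReal 0 v).map (fun x => x i)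
      = gaussianReal 0 v := fun i => (measurePreserving_eval (fun _ => gaussianReal 0 v) i).map_eq
  have hind : iIndepFun (fun (i : Fin n) (x : Fin n → ℝ) => x i)
      (Measure.pi fun _ : Fin n => gaussianReal 0 v) :=
    iIndepFun_pi (X := fun _ => id) fun _ => aemeasurable_id
  have hY : (Measure.pi fun _ : Fin n => gaussianReal 0 v).map (fun x => -x k)
      = gaussianReal 0 v := by
    have := Measure.map_map (μ := Measure.pi fun _ : Fin n => gaussianReal 0 v)
      (measurable_neg : Measurable fun x : ℝ => -x) (measurable_pi_apply k)
    rw [hX k, gaussianReal_map_neg, neg_zero] at this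
    exact this.symm
  have h2 := gaussianReal_add_gaussianReal_of_indepFun
    ((hind.indepFun hjk).comp measurable_id measurable_neg) (hX j) hY
  rw [add_zero, ← two_mul] at h2
  exact h2

/-- A Monte Carlo argument in place of Bochner's theorem: average the defining inequality, with all
`a j = 1`, over `n` independent points of law `N(0, v)`. The diagonal contributes `n φ(0)` and the
other pairs `n (n - 1) E`, since differences have law `N(0, 2v)`. Dividing by `n²` and letting `n →
∞` leaves `E ≥ 0`. -/
theorem IsPosDef.integral_gaussianReal_nonneg {φ : ℝ → ℂ} (hφ : IsPosDef φ) (hc : Continuous φ)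
    {C : ℝ} (hC : ∀ ν, ‖φ ν‖ ≤ C) (v : ℝ≥0) : 0 ≤ ∫ ν, φ ν ∂gaussianReal 0 (2 * v) := by
  set E := ∫ ν, φ ν ∂gaussianReal 0 (2 * v)
  have main : ∀ n : ℕ, 0 ≤ (n : ℂ) * φ 0 + n * (n - 1) * E := by
    intro n
    set P := Measure.pi fun _ : Fin n => gaussianReal 0 v
    have hint : ∀ j k : Fin n, Integrable (fun x : Fin n → ℝ => φ (x j - x k)) P := fun j k =>
      Integrable.of_bound (hc.comp (by fun_prop)).aestronglyMeasurable C
        (ae_of_all _ fun x => hC _)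
    have hval : ∀ j k : Fin n, ∫ x, φ (x j - x k) ∂P = if j = k then φ 0 else E := by
      intro j k
      split_ifs with hjk
      · simp [hjk]
      · rw [← integral_map (φ := fun x : Fin n → ℝ => x j - x k)
          (by fun_prop) hc.aestronglyMeasurable, map_sub_pi_gaussianReal v hjk]
    have h1 : 0 ≤ ∫ x, ∑ j, ∑ k, φ (x j - x k) ∂P :=
      integral_nonneg fun x => by simpa using hφ n x fun _ => 1
    rw [integral_finsetSum _ fun j _ => integrable_finsetSum _ fun k _ => hint j k] at h1
    simp_rw [integral_finsetSum _ fun k _ => hint _ k, hval] at h1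
    convert h1 using 1
    have : ∀ j k : Fin n, (if j = k then φ 0 else E) = E + if j = k then φ 0 - E else 0 := by
      intro j k
      split_ifs <;> ring
    simp_rw [this, Finset.sum_add_distrib]
    simp
    ring
  have hl : Filter.Tendsto (fun n : ℕ => E + (φ 0 - E) * ((n : ℝ)⁻¹ : ℝ)) Filter.atTop (nhds E) := by
    have : Filter.Tendsto (fun n : ℕ => (((n : ℝ)⁻¹ : ℝ) : ℂ)) Filter.atTop (nhds ((0 : ℝ) : ℂ)) :=
      (continuous_ofReal.tendsto 0).comp tendsto_inv_atTop_nhds_zero_nat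
    simpa using (this.const_mul (φ 0 - E)).const_add E
  refine ge_of_tendsto hl ?_
  filter_upwards [Filter.eventually_gt_atTop 0] with n hn
  have h2 : (0 : ℂ) ≤ (((n : ℝ)⁻¹ ^ 2 : ℝ) : ℂ) := by
    rw [zero_le_real]
    positivity
  have h3 := mul_nonneg h2 (main n)
  convert h3 using 1
  have : (n : ℂ) ≠ 0 := by exact_mod_cast hn.ne'
  push_cast
  field_simp
  ring

theorem integrable_mul_exp_neg_sq {φ : ℝ → ℂ} (hc : Continuous φ) {C : ℝ}
    (hC : ∀ ν, ‖φ ν‖ ≤ C) {b : ℝ} (hb : 0 < b) :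
    Integrable fun ν : ℝ => φ ν * (Real.exp (-b * ν ^ 2) : ℂ) :=
  (integrable_exp_neg_mul_sq hb).ofReal.bdd_mul hc.aestronglyMeasurable (ae_of_all _ hC)

theorem IsPosDef.integral_mul_exp_neg_sq_nonneg {φ : ℝ → ℂ} (hφ : IsPosDef φ) (hc : Continuous φ)
    {C : ℝ} (hC : ∀ ν, ‖φ ν‖ ≤ C) {b : ℝ} (hb : 0 < b) :
    0 ≤ ∫ ν, φ ν * (Real.exp (-b * ν ^ 2) : ℂ) := by
  -- The density of `N(0, 2v)` is proportional to `exp (-ν² / (4v))`, which is `exp (-b ν²)` for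
  -- this `v`.
  set v : ℝ≥0 := ⟨(4 * b)⁻¹, by positivity⟩
  have hv : (v : ℝ) = (4 * b)⁻¹ := rfl
  have hv0 : v ≠ 0 := fun h => by
    have : (v : ℝ) = 0 := by rw [h]; rfl
    rw [hv] at this
    simp [hb.ne'] at this
  have h1 := hφ.integral_gaussianReal_nonneg hc hC v
  rw [integral_gaussianReal_eq_integral_smul (by simpa using hv0)] at h1
  have h2 : (0 : ℂ) ≤ ((Real.sqrt (2 * Real.pi * (2 * v)) : ℝ) : ℂ) := by
    rw [zero_le_real]
    positivity
  have h3 := mul_nonneg h2 h1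
  rw [← integral_const_mul] at h3
  refine h3.trans_eq (integral_congr_ae (ae_of_all _ fun ν => ?_))
  have hs : Real.sqrt (2 * Real.pi * (2 * v)) ≠ 0 := by
    have : (0 : ℝ) < v := by rw [hv]; positivity
    positivity
  have hs' : (Real.sqrt (2 * Real.pi * (2 * v)) : ℂ) ≠ 0 := by exact_mod_cast hs
  simp only [gaussianPDFReal, NNReal.coe_mul, NNReal.coe_ofNat, real_smul, sub_zero]
  have he : -ν ^ 2 / (2 * (2 * (v : ℝ))) = -b * ν ^ 2 := by
    rw [hv]
    field_simp
    norm_num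
  rw [he]
  push_cast
  field_simp

theorem fourier_eq_integral_exp (f : ℝ → ℂ) (w : ℝ) :
    𝓕 f w = ∫ x : ℝ, f x * exp (I * (-(2 * Real.pi * w) : ℝ) * x) := by
  rw [Real.fourier_real_eq_integral_exp_smul]
  refine integral_congr_ae (ae_of_all _ fun x => ?_)
  simp only [smul_eq_mul]
  rw [mul_comm]
  congr 2
  push_cast
  ring

theorem norm_exp_I_mul_mul (x y : ℝ) : ‖exp (I * x * y)‖ = 1 := by
  rw [mul_assoc, mul_comm, ← ofReal_mul, norm_exp_ofReal_mul_I]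

/-- Half of the Gaussian stays with `φ`, giving an integrable `ψ` whose transform `E` is nonnegative
and continuous. The other half is a characteristic function, which turns the integral into the mean
of `E` under `N(q, b)`. A zero mean would force `E = 0`, hence `ψ = 0` by Fourier inversion, against
`φ 0 ≠ 0`. -/
theorem IsPosDef.integral_mul_exp_pos {φ : ℝ → ℂ} (hφ : IsPosDef φ) (hc : Continuous φ)
    {C : ℝ} (hC : ∀ ν, ‖φ ν‖ ≤ C) {b : ℝ} (hb : 0 < b) (h0 : φ 0 ≠ 0) (q : ℝ) :
    0 < (∫ ν : ℝ, φ ν * exp (I * q * ν) * (Real.exp (-b * ν ^ 2) : ℂ)).re := by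
  set ψ : ℝ → ℂ := fun ν => φ ν * (Real.exp (-(b / 2) * ν ^ 2) : ℂ)
  have hψc : Continuous ψ := by fun_prop
  have hψi : Integrable ψ := integrable_mul_exp_neg_sq hc hC (half_pos hb)
  set E : ℝ → ℂ := fun x => ∫ ν : ℝ, ψ ν * exp (I * x * ν)
  have hE0 : ∀ x, 0 ≤ E x := fun x => by
    have := (hφ.mul_exp x).integral_mul_exp_neg_sq_nonneg (C := C) (by fun_prop)
      (fun ν => by rw [norm_mul, norm_exp_I_mul_mul, mul_one]; exact hC ν) (half_pos hb)
    convert this using 3 with ν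
    simp only [ψ]
    ring
  have hEc : Continuous E := by
    refine continuous_of_dominated (bound := fun ν => ‖ψ ν‖) (fun x => ?_)
      (fun x => ae_of_all _ fun ν => ?_) hψi.norm (ae_of_all _ fun ν => by fun_prop)
    · exact Continuous.aestronglyMeasurable (by fun_prop)
    · rw [norm_mul, norm_exp_I_mul_mul, mul_one]
  have hEb : ∀ x, ‖E x‖ ≤ ∫ ν, ‖ψ ν‖ := fun x =>
    (norm_integral_le_integral_norm _).trans_eq (by simp only [norm_mul, norm_exp_I_mul_mul, mul_one])
  -- The characteristic function of `N(q, b)` is `exp (i q ν - b ν² / 2)`: the phase and the missing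
  -- half of the Gaussian.
  set w : ℝ≥0 := ⟨b, hb.le⟩
  have hw : (w : ℝ) = b := rfl
  have hw0 : w ≠ 0 := fun h => hb.ne' (by rw [← hw, h]; rfl)
  have hEi : Integrable E (gaussianReal q w) :=
    Integrable.of_bound hEc.aestronglyMeasurable _ (ae_of_all _ hEb)
  have hswap : ∫ x, E x ∂gaussianReal q w
      = ∫ ν : ℝ, φ ν * exp (I * q * ν) * (Real.exp (-b * ν ^ 2) : ℂ) := by
    rw [integral_integral_swap]
    · refine integral_congr_ae (ae_of_all _ fun ν => ?_)
      have h1 := charFun_gaussianReal (μ := q) (v := w) ν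
      rw [charFun_apply_real] at h1
      simp only
      rw [integral_const_mul]
      have h2 : ∫ x : ℝ, exp (I * x * ν) ∂gaussianReal q w
          = exp (ν * q * I - w * ν ^ 2 / 2) := by
        rw [← h1]
        refine integral_congr_ae (ae_of_all _ fun x => ?_)
        simp only
        congr 1
        ring
      have h3 : ((w : ℝ) : ℂ) = (b : ℂ) := rfl
      rw [h2]
      simp only [ψ]
      push_cast
      simp only [h3, mul_assoc (φ ν), ← exp_add]
      congr 2
      ring
    · refine ((integrable_const (1 : ℂ)).mul_prod hψi).mono
        (Continuous.aestronglyMeasurable (by fun_prop)) (ae_of_all _ fun p => ?_)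
      simp only [Function.uncurry, norm_mul, norm_exp_I_mul_mul, mul_one, one_mul, le_refl]
  rw [← hswap]
  have hre : (∫ x, E x ∂gaussianReal q w).re = ∫ x, (E x).re ∂gaussianReal q w :=
    (integral_re hEi).symm
  rw [hre]
  have hnn : ∀ x, 0 ≤ (E x).re := fun x => (le_def.mp (hE0 x)).1
  refine lt_of_le_of_ne (integral_nonneg hnn) fun heq => h0 ?_
  have hz := (integral_eq_zero_iff_of_nonneg hnn hEi.re).mp heq.symm
  -- Lebesgue measure is absolutely continuous with respect to a nondegenerate Gaussian, so `Re E`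
  -- vanishes almost everywhere, and everywhere by continuity.
  have hz' := (gaussianReal_absolutelyContinuous' q hw0).ae_le hz
  have hz'' : (fun x => (E x).re) = fun _ => 0 :=
    Continuous.ae_eq_iff_eq volume (continuous_re.comp hEc) continuous_const |>.mp hz'
  have hE : ∀ x, E x = 0 := fun x =>
    Complex.ext (congrFun hz'' x) (le_def.mp (hE0 x)).2.symm
  have hF : 𝓕 ψ = 0 := funext fun w => by
    rw [fourier_eq_integral_exp]
    exact hE _
  have hinv := hψc.fourierInv_fourier_eq hψi (by rw [hF]; exact integrable_zero _ _ _)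
  rw [hF] at hinv
  have := congrFun hinv 0
  rw [Real.fourierInv_eq] at this
  simpa [ψ] using this.symm

end Hudson

/-! ### The Bargmann transform and Hudson's theorem -/

namespace Hudson

open Complex Filter
open scoped ComplexOrder ComplexConjugate FourierTransform

/-- The Bargmann transform of `g`, up to a Gaussian factor. -/
noncomputable def bargmann (g : ℝ → ℂ) (z : ℂ) : ℂ :=
  ∫ t : ℝ, g t * exp (-(1 / 2) * t ^ 2 + z * t)

/-- Giving up half of the Gaussian decay bounds the linear term by `r²`. This supplies both the
dominating function for differentiability and the order-two growth. -/
theorem neg_half_sq_add_mul_abs_le (r t : ℝ) :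
    -(1 / 2) * t ^ 2 + r * |t| ≤ r ^ 2 + -(1 / 4) * t ^ 2 := by
  have := sq_abs t
  nlinarith [sq_nonneg (|t| / 2 - r)]

theorem norm_exp_quadratic_le {r : ℝ} {z : ℂ} (hz : ‖z‖ ≤ r) (t : ℝ) :
    ‖exp (-(1 / 2) * t ^ 2 + z * t)‖ ≤ Real.exp (-(1 / 2) * t ^ 2 + r * |t|) := by
  have h1 : (-(1 / 2) * (t : ℂ) ^ 2 + z * t).re = -(1 / 2) * t ^ 2 + z.re * t := by
    have : -(1 / 2) * (t : ℂ) ^ 2 + z * t = ((-(1 / 2) * t ^ 2 : ℝ) : ℂ) + z * t := by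
      push_cast; ring
    rw [this, add_re, ofReal_re, re_mul_ofReal]
  have h2 : z.re * t ≤ r * |t| :=
    calc z.re * t ≤ |z.re * t| := le_abs_self _
      _ = |z.re| * |t| := abs_mul _ _
      _ ≤ r * |t| := by gcongr; exact (abs_re_le_norm z).trans hz
  rw [norm_exp, h1]
  exact Real.exp_le_exp.mpr (by linarith)

theorem integrable_mul_exp_quadratic {g : ℝ → ℂ} (hc : Continuous g) {C : ℝ}
    (hC : ∀ t, ‖g t‖ ≤ C) (z : ℂ) :
    Integrable fun t : ℝ => g t * exp (-(1 / 2) * t ^ 2 + z * t) := by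
  have := integrable_cexp_quadratic' (b := -(1 / 2)) (by norm_num) z 0
  simp only [add_zero] at this
  exact this.bdd_mul hc.aestronglyMeasurable (ae_of_all _ hC)

theorem differentiable_bargmann {g : ℝ → ℂ} (hc : Continuous g) {C : ℝ}
    (hC : ∀ t, ‖g t‖ ≤ C) : Differentiable ℂ (bargmann g) := by
  intro z₀
  have hC0 : 0 ≤ C := (norm_nonneg _).trans (hC 0)
  -- One unit covers the ball around `z₀`; the other absorbs the factor `t` from differentiation,
  -- through `|t| ≤ exp |t|`.
  set r := ‖z₀‖ + 2
  refine (hasDerivAt_integral_of_dominated_loc_of_deriv_le (μ := volume)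
    (F := fun z (t : ℝ) => g t * exp (-(1 / 2) * t ^ 2 + z * t))
    (F' := fun z (t : ℝ) => g t * (exp (-(1 / 2) * t ^ 2 + z * t) * t))
    (bound := fun t => C * (Real.exp (r ^ 2) * Real.exp (-(1 / 4) * t ^ 2)))
    (Metric.ball_mem_nhds z₀ one_pos) ?_ (integrable_mul_exp_quadratic hc hC z₀) ?_ ?_ ?_
    ?_).2.differentiableAt
  · exact Eventually.of_forall fun z => (integrable_mul_exp_quadratic hc hC z).1
  · exact Continuous.aestronglyMeasurable (by fun_prop)
  · refine ae_of_all _ fun t z hz => ?_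
    have hzr : ‖z‖ ≤ ‖z₀‖ + 1 := by
      have h1 : ‖z - z₀‖ < 1 := by simpa [dist_eq_norm] using hz
      have h2 := norm_add_le (z - z₀) z₀
      rw [sub_add_cancel] at h2
      linarith
    rw [norm_mul, norm_mul, ← Real.exp_add]
    gcongr
    · exact hC t
    · calc ‖exp (-(1 / 2) * t ^ 2 + z * t)‖ * ‖(t : ℂ)‖
          ≤ Real.exp (-(1 / 2) * t ^ 2 + (‖z₀‖ + 1) * |t|) * Real.exp |t| := by
            gcongr
            · exact norm_exp_quadratic_le hzr t
            · rw [norm_real, Real.norm_eq_abs]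
              linarith [Real.add_one_le_exp |t|]
        _ = Real.exp (-(1 / 2) * t ^ 2 + r * |t|) := by
            rw [← Real.exp_add]
            congr 1
            simp only [r]
            ring
        _ ≤ _ := Real.exp_le_exp.mpr (neg_half_sq_add_mul_abs_le r t)
  · exact ((integrable_exp_neg_mul_sq (by norm_num)).const_mul _).const_mul _
  · refine ae_of_all _ fun t z _ => ?_
    have h1 : HasDerivAt (fun z : ℂ => -(1 / 2) * (t : ℂ) ^ 2 + z * t) (t : ℂ) z := by
      simpa using ((hasDerivAt_id z).mul_const (t : ℂ)).const_add (-(1 / 2) * (t : ℂ) ^ 2)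
    exact h1.cexp.const_mul (g t)

theorem exists_norm_bargmann_le {g : ℝ → ℂ} {C : ℝ} (hC : ∀ t, ‖g t‖ ≤ C) :
    ∃ M, 0 < M ∧ ∀ z, ‖bargmann g z‖ ≤ Real.exp (M + 1 * ‖z‖ ^ 2) := by
  have hC0 : 0 ≤ C := (norm_nonneg _).trans (hC 0)
  set J := ∫ t : ℝ, Real.exp (-(1 / 4) * t ^ 2)
  have hJ : 0 ≤ J := integral_nonneg fun t => (Real.exp_pos _).le
  refine ⟨C * J + 1, by positivity, fun z => ?_⟩
  have hb : ‖bargmann g z‖ ≤ ∫ t : ℝ, C * (Real.exp (‖z‖ ^ 2) * Real.exp (-(1 / 4) * t ^ 2)) := by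
    refine norm_integral_le_of_norm_le
      (((integrable_exp_neg_mul_sq (by norm_num)).const_mul _).const_mul _)
      (ae_of_all _ fun t => ?_)
    rw [norm_mul, ← Real.exp_add]
    gcongr
    · exact hC t
    · exact (norm_exp_quadratic_le le_rfl t).trans
        (Real.exp_le_exp.mpr (neg_half_sq_add_mul_abs_le _ t))
  rw [integral_const_mul, integral_const_mul] at hb
  refine hb.trans ?_
  rw [Real.exp_add, one_mul]
  have h1 : C * J ≤ Real.exp (C * J + 1) := by linarith [Real.add_one_le_exp (C * J + 1)]
  calc C * (Real.exp (‖z‖ ^ 2) * J) = C * J * Real.exp (‖z‖ ^ 2) := by ring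
    _ ≤ _ := by gcongr

/-- A swap followed by two shears, so no Jacobian appears. -/
theorem measurePreserving_add_half_sub_half :
    MeasurePreserving (fun p : ℝ × ℝ => (p.1 + p.2 / 2, p.1 - p.2 / 2))
      (volume.prod volume) (volume.prod volume) := by
  have h1 : MeasurePreserving (fun p : ℝ × ℝ => (p.1, p.2 - p.1 / 2))
      (volume.prod volume) (volume.prod volume) :=
    (MeasurePreserving.id volume).skew_product (g := fun ν μ => μ - ν / 2) (by fun_prop)
      (Eventually.of_forall fun ν => (measurePreserving_sub_right volume (ν / 2)).map_eq)
  convert! (measurePreserving_add_prod (volume : Measure ℝ) (volume : Measure ℝ)).comp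
    (h1.comp Measure.measurePreserving_swap) using 1
  ext p <;> simp
  ring

/-- In the coordinates `(μ, ν)`, `|B(z)|²` is the integral of `exp (-μ² + 2 Re z μ) * G μ`, where `G
μ` is a Gaussian-damped Fourier integral of the positive definite function at `μ`. The integrand is
nonnegative, and positive on the nonempty open set where `g ≠ 0`. -/
theorem bargmann_ne_zero {g : ℝ → ℂ} (hc : Continuous g) {C : ℝ} (hC : ∀ t, ‖g t‖ ≤ C)
    (hpd : ∀ μ, IsPosDef fun ν => conj (g (μ + ν / 2)) * g (μ - ν / 2)) (h0 : g ≠ 0) (z : ℂ) :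
    bargmann g z ≠ 0 := by
  set k : ℝ → ℂ := fun t => g t * exp (-(1 / 2) * t ^ 2 + z * t)
  have hki : Integrable k := integrable_mul_exp_quadratic hc hC z
  have hkc : Continuous k := by fun_prop
  set Φ : ℝ × ℝ → ℝ × ℝ := fun p => (p.1 + p.2 / 2, p.1 - p.2 / 2)
  have hΦ : MeasurePreserving Φ (volume.prod volume) (volume.prod volume) :=
    measurePreserving_add_half_sub_half
  set F : ℝ × ℝ → ℂ := fun p => conj (k p.1) * k p.2
  have hkci : Integrable fun t => conj (k t) :=
    hki.mono (continuous_conj.comp hkc).aestronglyMeasurable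
      (ae_of_all _ fun t => by simp)
  have hFi : Integrable F (volume.prod volume) := hkci.mul_prod hki
  have hFΦ : Integrable (fun p => F (Φ p)) (volume.prod volume) := hΦ.integrable_comp_of_integrable hFi
  set G : ℝ → ℂ := fun μ => ∫ ν : ℝ, conj (g (μ + ν / 2)) * g (μ - ν / 2) *
    exp (I * (-z.im : ℝ) * ν) * (Real.exp (-(1 / 4) * ν ^ 2) : ℂ)
  have hin : ∀ μ, ∫ ν, F (Φ (μ, ν)) = (Real.exp (-μ ^ 2 + 2 * z.re * μ) : ℂ) * G μ := by
    intro μ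
    rw [← integral_const_mul]
    refine integral_congr_ae (ae_of_all _ fun ν => ?_)
    simp only [F, Φ, k, map_mul]
    rw [← exp_conj]
    -- With `s = μ + ν/2` and `t = μ - ν/2`: `(s² + t²)/2 = μ² + ν²/4` and `conj z * s + z * t = 2
    -- Re z μ - i Im z ν`.
    have e : exp (conj (-(1 / 2) * ((μ + ν / 2 : ℝ) : ℂ) ^ 2 + z * ((μ + ν / 2 : ℝ) : ℂ)))
        * exp (-(1 / 2) * ((μ - ν / 2 : ℝ) : ℂ) ^ 2 + z * ((μ - ν / 2 : ℝ) : ℂ))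
        = (Real.exp (-μ ^ 2 + 2 * z.re * μ) : ℂ) * exp (I * (-z.im : ℝ) * ν)
          * (Real.exp (-(1 / 4) * ν ^ 2) : ℂ) := by
      rw [ofReal_exp, ofReal_exp, ← exp_add, ← exp_add, ← exp_add]
      congr 1
      have hz : conj z = z.re - z.im * I := by
        apply Complex.ext <;> simp
      simp only [map_add, map_mul, map_neg, map_div₀, map_one, map_ofNat, map_pow, conj_ofReal, hz]
      push_cast
      linear_combination ((ν : ℂ) / 2 - μ) * re_add_im z
    linear_combination (conj (g (μ + ν / 2)) * g (μ - ν / 2)) * e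
  have hφC : ∀ μ ν, ‖conj (g (μ + ν / 2)) * g (μ - ν / 2)‖ ≤ C * C := fun μ ν => by
    rw [norm_mul, RCLike.norm_conj]
    gcongr
    · exact (norm_nonneg _).trans (hC 0)
    · exact hC _
    · exact hC _
  have hG0 : ∀ μ, 0 ≤ (G μ).re := fun μ => by
    refine (le_def.mp (((hpd μ).mul_exp (-z.im)).integral_mul_exp_neg_sq_nonneg (b := 1 / 4)
      (C := C * C) (by fun_prop) (fun ν => ?_) (by norm_num))).1
    rw [norm_mul, norm_exp_I_mul_mul, mul_one]
    exact hφC μ ν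
  -- At `ν = 0` the positive definite function equals `|g μ|²`.
  have hGpos : ∀ μ, g μ ≠ 0 → 0 < (G μ).re := fun μ hμ =>
    (hpd μ).integral_mul_exp_pos (by fun_prop) (hφC μ) (by norm_num) (by simpa using hμ) _
  have hprod : conj (bargmann g z) * bargmann g z
      = ∫ μ : ℝ, (Real.exp (-μ ^ 2 + 2 * z.re * μ) : ℂ) * G μ := by
    have h1 : conj (bargmann g z) = ∫ t, conj (k t) := integral_conj.symm
    have h2 : bargmann g z = ∫ t, k t := rfl
    rw [h1, h2, ← integral_prod_mul (fun t => conj (k t)) k]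
    simp_rw [← hin]
    rw [← integral_prod (fun p => F (Φ p)) hFΦ]
    have h3 := integral_map (μ := (volume : Measure ℝ).prod volume) (φ := Φ) (f := F)
      hΦ.measurable.aemeasurable (by rw [hΦ.map_eq]; exact hFi.1)
    rw [hΦ.map_eq] at h3
    exact h3
  have hint : Integrable fun μ : ℝ => (Real.exp (-μ ^ 2 + 2 * z.re * μ) : ℂ) * G μ := by
    simpa only [hin] using hFΦ.integral_prod_left
  have hpos : 0 < (∫ μ : ℝ, (Real.exp (-μ ^ 2 + 2 * z.re * μ) : ℂ) * G μ).re := by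
    have hre : (∫ μ : ℝ, (Real.exp (-μ ^ 2 + 2 * z.re * μ) : ℂ) * G μ).re
        = ∫ μ : ℝ, Real.exp (-μ ^ 2 + 2 * z.re * μ) * (G μ).re := by
      refine (integral_re hint).symm.trans (integral_congr_ae (ae_of_all _ fun μ => ?_))
      exact re_ofReal_mul _ _
    have hint' : Integrable fun μ : ℝ => Real.exp (-μ ^ 2 + 2 * z.re * μ) * (G μ).re := by
      refine hint.re.congr (ae_of_all _ fun μ => ?_)
      exact re_ofReal_mul _ _
    rw [hre, integral_pos_iff_support_of_nonneg
      (fun μ => mul_nonneg (Real.exp_pos _).le (hG0 μ)) hint']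
    obtain ⟨μ₀, hμ₀⟩ := Function.ne_iff.mp h0
    refine ((isOpen_ne_fun hc continuous_const).measure_pos volume ⟨μ₀, hμ₀⟩).trans_le
      (measure_mono fun μ hμ => ?_)
    exact (mul_pos (Real.exp_pos _) (hGpos μ hμ)).ne'
  rw [← hprod] at hpos
  intro hB
  simp [hB] at hpos

/-- Multiplying the values at `w` and `-w` cancels the linear term. If `Re a ≥ 0`, the product has
norm at least `exp (2 Re c)` and cannot tend to zero. -/
theorem re_neg_of_tendsto_exp_quadratic {a b c : ℂ}
    (h : Tendsto (fun w : ℝ => exp (a * (w : ℂ) ^ 2 + b * w + c)) (cocompact ℝ) (nhds 0)) :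
    a.re < 0 := by
  by_contra! ha
  have h1 : Tendsto (fun w : ℝ => exp (a * (w : ℂ) ^ 2 + b * w + c)) atTop (nhds 0) :=
    h.mono_left atTop_le_cocompact
  have h2 : Tendsto (fun w : ℝ => exp (a * ((-w : ℝ) : ℂ) ^ 2 + b * ((-w : ℝ) : ℂ) + c)) atTop
      (nhds 0) := (h.mono_left atBot_le_cocompact).comp tendsto_neg_atTop_atBot
  have h3 := (h1.mul h2).norm
  rw [mul_zero, norm_zero] at h3
  refine (Real.exp_pos (2 * c.re)).not_ge (ge_of_tendsto h3 (Eventually.of_forall fun w => ?_))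
  have e : exp (a * (w : ℂ) ^ 2 + b * w + c) * exp (a * ((-w : ℝ) : ℂ) ^ 2 + b * ((-w : ℝ) : ℂ) + c)
      = exp (a * ((2 * w ^ 2 : ℝ) : ℂ) + c * (2 : ℝ)) := by
    rw [← exp_add]
    congr 1
    push_cast
    ring
  rw [e, norm_exp, add_re, re_mul_ofReal, re_mul_ofReal]
  gcongr
  nlinarith [mul_nonneg ha (sq_nonneg w)]

/-- A form of **Hudson's theorem**: a continuous function vanishing at infinity whose Wigner
function is nonnegative is a Gaussian. -/
theorem eq_gaussian_of_isPosDef {g : ℝ → ℂ} (hc : Continuous g) {C : ℝ} (hC : ∀ t, ‖g t‖ ≤ C)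
    (hlim : Tendsto g (cocompact ℝ) (nhds 0))
    (hpd : ∀ μ, IsPosDef fun ν => conj (g (μ + ν / 2)) * g (μ - ν / 2)) (h0 : g ≠ 0) :
    ∃ a b c : ℂ, 0 < a.re ∧ ∀ μ : ℝ, g μ = exp (-a * (μ : ℂ) ^ 2 + b * μ + c) := by
  obtain ⟨M, hM, hBM⟩ := exists_norm_bargmann_le hC
  obtain ⟨α, β, κ, hB⟩ := exists_eq_exp_quadratic (differentiable_bargmann hc hC)
    (bargmann_ne_zero hc hC hpd h0) hM zero_le_one hBM
  set u : ℝ → ℂ := fun t => g t * exp (-(1 / 2) * t ^ 2)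
  have hui : Integrable u := by simpa [u] using integrable_mul_exp_quadratic hc hC 0
  have huc : Continuous u := by fun_prop
  -- `A` and `D` are the coefficients of the quadratic exponent after substituting `z = -2πi w`,
  -- where `B` becomes the Fourier transform of `u`.
  obtain ⟨A, hA⟩ : ∃ A : ℂ, A = α * (-(2 * Real.pi * I)) ^ 2 := ⟨_, rfl⟩
  obtain ⟨D, hD⟩ : ∃ D : ℂ, D = β * -(2 * Real.pi * I) := ⟨_, rfl⟩
  have hFu : 𝓕 u = fun w : ℝ => exp (A * (w : ℂ) ^ 2 + D * w + κ) := by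
    funext w
    have h1 : 𝓕 u w = bargmann g (-(2 * Real.pi * I) * w) := by
      rw [fourier_eq_integral_exp]
      refine integral_congr_ae (ae_of_all _ fun t => ?_)
      simp only [u]
      rw [mul_assoc, ← exp_add]
      congr 2
      push_cast
      ring
    rw [h1, hB, hA, hD]
    congr 1
    ring
  have hAre : A.re < 0 := by
    refine re_neg_of_tendsto_exp_quadratic (b := D) (c := κ) ?_
    rw [← hFu]
    -- Riemann–Lebesgue gives the decay of this exponential, hence its integrability for Fourier
    -- inversion.
    exact Real.zero_at_infty_fourier u
  have hA0 : A ≠ 0 := fun h => by simp [h] at hAre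
  have hinv := huc.fourierInv_fourier_eq hui (by
    rw [hFu]; exact integrable_cexp_quadratic' hAre D κ)
  have hu : ∀ t, u t = (Real.pi / -A) ^ (1 / 2 : ℂ) *
      exp (κ - (D + 2 * Real.pi * I * t) ^ 2 / (4 * A)) := fun t => by
    rw [← integral_cexp_quadratic hAre, ← congrFun hinv t, hFu,
      Real.fourierInv_eq_fourier_neg, fourier_eq_integral_exp]
    refine integral_congr_ae (ae_of_all _ fun w => ?_)
    simp only
    rw [← exp_add]
    congr 1
    push_cast
    ring
  -- Being nonzero, the prefactor can be written with `log` and moved into the constant term of the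
  -- exponent.
  have hpi : (Real.pi : ℂ) / -A ≠ 0 :=
    div_ne_zero (by exact_mod_cast Real.pi_ne_zero) (neg_ne_zero.mpr hA0)
  have hg : ∀ t : ℝ, g t = exp ((1 / 2 + Real.pi ^ 2 / A) * (t : ℂ) ^ 2
      + -(Real.pi * I * D / A) * t + (log (Real.pi / -A) * (1 / 2) + κ - D ^ 2 / (4 * A))) := by
    intro t
    have h1 : g t = u t * exp (1 / 2 * t ^ 2) := by
      simp only [u]
      rw [mul_assoc, ← exp_add]
      simp
    rw [h1, hu, cpow_def_of_ne_zero hpi, ← exp_add, ← exp_add]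
    congr 1
    field_simp
    linear_combination (-(8 * Real.pi ^ 2) * (t : ℂ) ^ 2) * I_sq
  refine ⟨-(1 / 2 + Real.pi ^ 2 / A), _, _, ?_, fun μ => by rw [neg_neg]; exact hg μ⟩
  rw [neg_re, neg_pos]
  exact re_neg_of_tendsto_exp_quadratic (hlim.congr hg)

end Hudson

/-! ### From positivity of the Wigner transform to positive definiteness -/

namespace BohrWigner

open scoped ComplexOrder ComplexConjugate FourierTransform

theorem single_mem_CylDualGroup (μ : ℝ) : (Pi.single μ 1 : ℝ → ℂ) ∈ CylDualGroup :=
  ⟨⟨h μ, h_mem_Cyl μ⟩, fourier_h μ⟩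

/-- The character `h_ν` on `RB`, tensored with the indicator function of the point `μ`. -/
noncomputable def phaseChar (ν μ : ℝ) : CylPhase :=
  ⟨fun p => h ν p.1 * (Pi.single μ 1 : ℝ → ℂ) p.2, Submodule.subset_span
    ⟨h ν, h_mem_Cyl ν, Pi.single μ 1, single_mem_CylDualGroup μ, rfl⟩⟩

theorem partialFourier_phaseChar (ν μ : ℝ) (p : ℝ × ℝ) :
    partialFourier (phaseChar ν μ) p.1 p.2 = if p = (ν, μ) then 1 else 0 := by
  have : partialFourier (phaseChar ν μ) p.1 p.2
      = (Pi.single μ 1 : ℝ → ℂ) p.2 * (Pi.single ν 1 : ℝ → ℂ) p.1 := by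
    rw [← fourier_h ν, ← smul_eq_mul, ← Pi.smul_apply, ← fourier_smul]
    unfold partialFourier
    congr 1
    funext c
    exact mul_comm _ _
  rw [this, Pi.single_apply, Pi.single_apply]
  obtain ⟨a, b⟩ := p
  by_cases ha : a = ν <;> by_cases hb : b = μ <;> simp [ha, hb]

theorem wigner_phaseChar (Γ Γ' : CylDist) (ν μ : ℝ) :
    wigner Γ Γ' (phaseChar ν μ) = conj (Γ.coeff (μ + ν / 2)) * Γ'.coeff (μ - ν / 2) := by
  change ∑ᶠ p : ℝ × ℝ, star (Γ.coeff (p.2 + p.1 / 2)) * Γ'.coeff (p.2 - p.1 / 2)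
    * partialFourier (phaseChar ν μ) p.1 p.2 = _
  simp only [partialFourier_phaseChar]
  rw [finsum_eq_single _ (ν, μ) fun p hp => by simp [hp]]
  simp

theorem h_sub (x y : ℝ) (c : RB) : h (x - y) c = h x c * conj (h y c) := by
  have hy : h y c * conj (h y c) = 1 := by
    rw [Complex.mul_conj, Complex.normSq_eq_norm_sq, h, Circle.norm_coe]
    norm_num
  have := h_add (x - y) y c
  rw [sub_add_cancel] at this
  rw [this, mul_assoc, hy, mul_one]

/-- The test function is `|∑ a_j h_{x_j}|²` times the indicator of `{μ}`. Expanding the square into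
the characters `h_{x_j - x_k}` yields exactly the quadratic form of positive definiteness. -/
theorem isPosDef_of_isPositive_wigner {Γ : CylDist} (hW : (wigner Γ Γ).IsPositive) (μ : ℝ) :
    Hudson.IsPosDef fun ν => conj (Γ.coeff (μ + ν / 2)) * Γ.coeff (μ - ν / 2) := by
  intro n x a
  have key := hW (∑ j, ∑ k, (a j * conj (a k)) • phaseChar (x j - x k) μ) fun p => ?_
  · simpa only [map_sum, map_smul, smul_eq_mul, wigner_phaseChar] using key
  · have e : ((∑ j, ∑ k, (a j * conj (a k)) • phaseChar (x j - x k) μ : CylPhase) :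
        RB × ℝ → ℂ) p = (∑ j, a j * h (x j) p.1) * conj (∑ j, a j * h (x j) p.1)
          * (Pi.single μ 1 : ℝ → ℂ) p.2 := by
      simp only [Submodule.coe_sum, Submodule.coe_smul, Finset.sum_apply, Pi.smul_apply,
        smul_eq_mul, phaseChar, h_sub, map_sum, map_mul, Finset.sum_mul, Finset.mul_sum]
      rw [Finset.sum_comm]
      refine Finset.sum_congr rfl fun j _ => Finset.sum_congr rfl fun k _ => ?_
      ring
    rw [e, Complex.mul_conj, Pi.single_apply]
    refine mul_nonneg (Complex.zero_le_real.mpr (Complex.normSq_nonneg _)) ?_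
    split_ifs <;> simp

end BohrWigner

/-! ### Injectivity of the Fourier transform on integrable functions -/

namespace Hudson

open scoped FourierTransform

/-- Every smooth compactly supported `f` is the transform of a Schwartz function, so the
multiplication formula turns `∫ f γ` into `∫ (𝓕⁻ f) (𝓕 γ) = 0`. -/
theorem ae_eq_zero_of_fourier_eq_zero {γ : ℝ → ℂ} (hγ : Integrable γ) (h0 : 𝓕 γ = 0) :
    γ =ᵐ[volume] 0 := by
  refine ae_eq_zero_of_integral_contDiff_smul_eq_zero hγ.locallyIntegrable fun f hf hfs => ?_
  have hfs' : HasCompactSupport fun x => (f x : ℂ) :=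
    hfs.comp_left (g := fun x : ℝ => (x : ℂ)) Complex.ofReal_zero
  have hf' : ContDiff ℝ (⊤ : ℕ∞) fun x => (f x : ℂ) := Complex.ofRealCLM.contDiff.comp hf
  set φ : SchwartzMap ℝ ℂ := hfs'.toSchwartzMap hf'
  have hφ : 𝓕 ((𝓕⁻ φ : SchwartzMap ℝ ℂ) : ℝ → ℂ) = φ := by
    rw [← SchwartzMap.fourier_coe, FourierTransform.fourier_fourierInv_eq]
  have key := VectorFourier.integral_fourierIntegral_smul_eq_flip (μ := volume) (ν := volume)
    (L := innerₗ ℝ) Real.continuous_fourierChar continuous_inner hγ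
    (𝓕⁻ φ : SchwartzMap ℝ ℂ).integrable
  have h1 : VectorFourier.fourierIntegral Real.fourierChar volume (innerₗ ℝ) γ = 0 := h0
  have h2 : VectorFourier.fourierIntegral Real.fourierChar volume (innerₗ ℝ).flip
      ((𝓕⁻ φ : SchwartzMap ℝ ℂ) : ℝ → ℂ) = φ := by
    rw [flip_innerₗ]; exact hφ
  rw [h1, h2] at key
  simp only [Pi.zero_apply, zero_smul, integral_zero] at key
  rw [key]
  refine integral_congr_ae (ae_of_all _ fun x => ?_)
  change f x • γ x = γ x • (f x : ℂ)
  rw [Complex.real_smul, smul_eq_mul, mul_comm]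

end Hudson

/-! ### The theorem for Fourier transforms of integrable functions -/

open scoped FourierTransform in
theorem mainTheorem4 (γ : ℝ → ℂ) (hγ₁ : MemLp γ 1 volume) (hγ₂ : MemLp γ 2 volume)
    (hγ₀ : ¬ γ =ᵐ[volume] 0) (Γ : BohrWigner.CylDist)
    (hΓ : ∀ μ : ℝ, Γ.coeff μ = ∫ x : ℝ, γ x * Complex.exp (-(Complex.I * μ * x)))
    (hW : (BohrWigner.wigner Γ Γ).IsPositive) :
    Γ.IsGaussian := by
  have hγ : Integrable γ := memLp_one_iff_integrable.mp hγ₁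
  have hF : ∀ w, 𝓕 γ w = Γ.coeff (2 * Real.pi * w) := fun w => by
    rw [hΓ, Hudson.fourier_eq_integral_exp]
    refine integral_congr_ae (ae_of_all _ fun x => ?_)
    simp only
    congr 2
    push_cast
    ring
  have hpi : 2 * Real.pi ≠ 0 := by positivity
  have hcoeff : Γ.coeff = fun μ => 𝓕 γ ((2 * Real.pi)⁻¹ * μ) := funext fun μ => by
    rw [hF, mul_inv_cancel_left₀ hpi]
  -- Up to rescaling by `2π` the coefficients are `𝓕 γ`: continuous, bounded by the `L¹` norm,
  -- vanishing at infinity by Riemann–Lebesgue, and not identically zero by injectivity.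
  refine Hudson.eq_gaussian_of_isPosDef (C := ∫ x, ‖γ x‖) ?_ (fun μ => ?_) ?_
    (BohrWigner.isPosDef_of_isPositive_wigner hW) fun h0 => hγ₀ ?_
  · rw [hcoeff]
    exact (VectorFourier.fourierIntegral_continuous Real.continuous_fourierChar
      (L := innerₗ ℝ) continuous_inner hγ).comp (continuous_const.mul continuous_id)
  · rw [hcoeff]
    exact VectorFourier.norm_fourierIntegral_le_integral_norm _ _ _ _ _
  · rw [hcoeff]
    exact (Real.zero_at_infty_fourier γ).comp
      (Homeomorph.mulLeft₀ (2 * Real.pi)⁻¹ (inv_ne_zero hpi)).isClosedEmbedding.tendsto_cocompact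
  · refine Hudson.ae_eq_zero_of_fourier_eq_zero hγ (funext fun w => ?_)
    rw [hF, h0]
    rfl
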